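/- Let $n\ge 1$, let $\overline N=\mathbb Z^{n-1}$ with standard basis $e_1,\dots,e_{n-1}$, let $\overline M=\mathbb Z^{n-1}$ be its dual, and put $N=\mathbb Z\oplus\overline N\oplus\mathbb Z$, with dual $M=\mathbb Z\oplus\overline M\oplus\mathbb Z$. Let the symmetric group $\mathfrak S_n$ act linearly on $N$ by $$s\cdot(a,w,c)=\bigl(a-w_{s^{-1}(n)},\ (w_{s^{-1}(i)}-w_{s^{-1}(n)})_{1\le i\le n-1},\ c+w_{s^{-1}(n)}\bigr),\qquad w_n:=0 .$$ Thus $(k\ \,k{+}1)$ with $k\le n-2$ interchanges $w_k$ and $w_{k+1}$, and $(n{-}1\ \,n)$ sends $(a,w,c)$ to $(a-w_{n-1},\,(w_1-w_{n-1},\dots,w_{n-2}-w_{n-1},-w_{n-1}),\,c+w_{n-1})$. Let $\delta^{(n)}\subset N_{\mathbb R}$ be the cone generated by the vectors $(1,\,e_1+\dots+e_j,\,0)$ for $0\le j\le n-1$ and by $(0,0,1)$. Let $\Delta^{(n)}$ be the set of all faces of the cones $s\,\delta^{(n)}$, $s\in\mathfrak S_n$, let $\sigma^{(n)}=\bigcup_{s}s\,\delta^{(n)}$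 be its support, and let $\sigma^{(n)\vee}\subset M_{\mathbb R}$ be the dual cone. Let $$P^{(n)}=\operatorname{conv}\{(s(1)-1,\dots,s(n-1)-(n-1))\mid s\in\mathfrak S_n\}\subset\overline M_{\mathbb R}$$ be the permutahedron, let $\iota:\overline M_{\mathbb R}\to M_{\mathbb R}$ be the inclusion of the middle summand, and put $\tilde P^{(n)}=\sigma^{(n)\vee}+\iota P^{(n)}$. Then the (inner) normal fan of the polyhedron $\tilde P^{(n)}$, that is, the set of the normal cones of its nonempty faces, is $\Delta^{(n)}$. In particular, it is a fan (a finite set of strongly convex rational polyhedral cones, closed under taking faces, in which any two cones intersect in a common face). The complex toric variety $X(\tilde P^{(n)})$, which is by definition the toric variety of the normal fan of $\tilde P^{(n)}$, is isomorphic to the toric variety $\tilde Z^{(n)\prime}=X(\Delta^{(n)})$, by an isomorphism over $\operatorname{Spec}\mathbb C$ that restricts to the identity on the torus $\operatorname{Spec}\mathbb C[M]$. -/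

import Mathlib

open CategoryTheory CategoryTheory.Limits AlgebraicGeometry
open scoped Pointwise

noncomputable section

namespace Toric

/-! ### Rational polyhedral cones and fans

The lattices `N` and `M = Hom(N, ℤ)` are both written as `ι → ℤ`, the real vector spaces `N_ℝ` and
`M_ℝ` as `ι → ℝ`, and the perfect pairing between them is the dot product `⬝ᵥ`. -/

section Fans

variable {ι : Type} [Fintype ι]

/-- The inclusion of the lattice `ℤ^ι` into the real vector space `ℝ^ι`. -/
def toReal (m : ι → ℤ) : ι → ℝ := fun i => (m i : ℝ)

/-- A rational polyhedral cone: generated by finitely many lattice vectors. -/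
def IsRationalPolyhedral (σ : PointedCone ℝ (ι → ℝ)) : Prop :=
  ∃ S : Finset (ι → ℤ), σ = PointedCone.hull ℝ (toReal '' (S : Set (ι → ℤ)))

/-- `τ` is a face of the cone `σ`: `τ = σ ∩ m^⊥` for some `m` in the dual cone of `σ`. -/
def IsFace (τ σ : PointedCone ℝ (ι → ℝ)) : Prop :=
  ∃ m : ι → ℝ, (∀ u ∈ σ, 0 ≤ m ⬝ᵥ u) ∧ ∀ u, u ∈ τ ↔ u ∈ σ ∧ m ⬝ᵥ u = 0

/-- A fan: a finite collection of strongly convex rational polyhedral cones which is closed under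
taking faces and in which any two cones intersect in a common face. -/
structure IsFan (C : Set (PointedCone ℝ (ι → ℝ))) : Prop where
  finite : C.Finite
  rational : ∀ σ ∈ C, IsRationalPolyhedral σ
  stronglyConvex : ∀ σ ∈ C, ∀ u ∈ σ, -u ∈ σ → u = 0
  face_mem : ∀ σ ∈ C, ∀ τ, IsFace τ σ → τ ∈ C
  inter_face : ∀ σ ∈ C, ∀ τ ∈ C, IsFace (σ ⊓ τ) σ ∧ IsFace (σ ⊓ τ) τ

variable (ι) in
/-- A fan in `ℝ^ι` with respect to the lattice `ℤ^ι`. -/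
structure Fan where
  cones : Set (PointedCone ℝ (ι → ℝ))
  isFan : IsFan cones

/-- The normal cone of a subset `Q` of `P`: all `u` which, as linear functionals on `P`, attain
their minimum at every point of `Q`. -/
def normalCone (P Q : Set (ι → ℝ)) : PointedCone ℝ (ι → ℝ) where
  carrier := {u | ∀ q ∈ Q, ∀ p ∈ P, q ⬝ᵥ u ≤ p ⬝ᵥ u}
  zero_mem' := by simp
  add_mem' := by
    intro a b ha hb q hq p hp
    simp only [dotProduct_add]
    exact add_le_add (ha q hq p hp) (hb q hq p hp)
  smul_mem' := by
    intro c a ha q hq p hp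
    have h : ∀ x : ι → ℝ, x ⬝ᵥ (c • a) = (c : ℝ) * (x ⬝ᵥ a) := fun x => by
      rw [← smul_eq_mul, ← dotProduct_smul]; rfl
    rw [h, h]
    exact mul_le_mul_of_nonneg_left (ha q hq p hp) c.2

/-- The (inner) normal fan of a polyhedron `P`: the normal cones of all nonempty faces of `P`, where
a face is the set of points of `P` at which some linear functional is extremal. -/
def normalFan (P : Set (ι → ℝ)) : Set (PointedCone ℝ (ι → ℝ)) :=
  {σ | ∃ Q : Set (ι → ℝ), Q.Nonempty ∧ IsExposed ℝ P Q ∧ σ = normalCone P Q}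

end Fans

/-! ### The toric variety of a fan -/

section ToricVariety

variable {ι : Type} [Fintype ι]

/-- The semigroup `σ^∨ ∩ M`. -/
def dualMonoid (σ : PointedCone ℝ (ι → ℝ)) : AddSubmonoid (ι → ℤ) where
  carrier := {m | ∀ u ∈ σ, 0 ≤ toReal m ⬝ᵥ u}
  zero_mem' := by
    intro u _
    have : toReal (0 : ι → ℤ) = 0 := by ext; simp [toReal]
    simp [this]
  add_mem' := by
    intro a b ha hb u hu
    have : toReal (a + b) = toReal a + toReal b := by ext; simp [toReal]
    rw [this, add_dotProduct]
    exact add_nonneg (ha u hu) (hb u hu)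

lemma dualMonoid_anti {τ σ : PointedCone ℝ (ι → ℝ)} (h : τ ≤ σ) :
    dualMonoid σ ≤ dualMonoid τ :=
  fun _ hm u hu => hm u (h hu)

/-- The affine toric variety `U_σ = Spec ℂ[σ^∨ ∩ M]`. -/
abbrev affineToric (σ : PointedCone ℝ (ι → ℝ)) : Scheme.{0} :=
  Spec (CommRingCat.of (AddMonoidAlgebra ℂ (dualMonoid σ)))

/-- The ring map `ℂ[σ^∨ ∩ M] → ℂ[τ^∨ ∩ M]` for cones `τ ⊆ σ`. -/
def dualMap {τ σ : PointedCone ℝ (ι → ℝ)} (h : τ ≤ σ) :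
    AddMonoidAlgebra ℂ (dualMonoid σ) →+* AddMonoidAlgebra ℂ (dualMonoid τ) :=
  AddMonoidAlgebra.mapDomainRingHom ℂ (AddSubmonoid.inclusion (dualMonoid_anti h))

/-- The gluing diagram of a collection of cones: the affine toric varieties `U_σ`, with the
morphisms `U_τ ⟶ U_σ` for `τ ⊆ σ` (in a fan: for `τ` a face of `σ`). -/
def gluingDiagram (C : Set (PointedCone ℝ (ι → ℝ))) : C ⥤ Scheme.{0} where
  obj σ := affineToric σ.1
  map f := Spec.map (CommRingCat.ofHom (dualMap (leOfHom f)))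
  map_id σ := by
    rw [← Spec.map_id]
    exact congrArg (fun g => Spec.map (CommRingCat.ofHom g))
      (AddMonoidAlgebra.mapDomainRingHom_id (R := ℂ) (M := dualMonoid σ.1))
  map_comp f g := by
    rw [← Spec.map_comp, ← CommRingCat.ofHom_comp, dualMap, dualMap, dualMap,
      ← AddMonoidAlgebra.mapDomainRingHom_comp]
    rfl

/-! The next lemmas show that in a fan the maps of the gluing diagram are open immersions and that
the diagram is locally directed, so that its colimit exists and is the gluing of the `U_σ`. -/

/-- A linear inequality system with integral coefficients that has a real solution has an integral
solution with the same sign pattern. -/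
lemma exists_integral (S : Finset (ι → ℤ)) (m : ι → ℝ) (hm : ∀ g ∈ S, 0 ≤ m ⬝ᵥ toReal g) :
    ∃ m' : ι → ℤ, ∀ g ∈ S, 0 ≤ toReal m' ⬝ᵥ toReal g ∧
      (toReal m' ⬝ᵥ toReal g = 0 ↔ m ⬝ᵥ toReal g = 0) := by
  classical
  let V : Submodule ℚ ℝ := Submodule.span ℚ (Set.range m)
  have hmV : ∀ i, m i ∈ V := fun i => Submodule.subset_span ⟨i, rfl⟩
  have : FiniteDimensional ℚ V := FiniteDimensional.span_of_finite ℚ (Set.finite_range m)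
  let b := Module.finBasis ℚ V
  let c : ι → Fin (Module.finrank ℚ V) → ℚ := fun i => b.repr ⟨m i, hmV i⟩
  have hc : ∀ i, m i = ∑ j, (c i j : ℝ) * (b j : ℝ) := by
    intro i
    have h := congrArg Subtype.val (b.sum_repr ⟨m i, hmV i⟩)
    simp only [Submodule.coe_sum, Submodule.coe_smul] at h
    rw [← h]
    exact Finset.sum_congr rfl fun j _ => Rat.smul_def _ _
  let L : (ι → ℤ) → Fin (Module.finrank ℚ V) → ℚ := fun g j => ∑ i, c i j * g i
  have hL : ∀ (g : ι → ℤ) (x : Fin (Module.finrank ℚ V) → ℝ),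
      (fun i => ∑ j, (c i j : ℝ) * x j) ⬝ᵥ toReal g = ∑ j, (L g j : ℝ) * x j := by
    intro g x
    simp only [dotProduct, toReal, L, Rat.cast_sum, Rat.cast_mul, Rat.cast_intCast,
      Finset.sum_mul]
    rw [Finset.sum_comm]
    exact Finset.sum_congr rfl fun j _ => Finset.sum_congr rfl fun i _ => by ring
  have hmL : ∀ g : ι → ℤ, m ⬝ᵥ toReal g = ∑ j, (L g j : ℝ) * (b j : ℝ) := by
    intro g
    rw [← hL, ← funext hc]
  let U : Set (Fin (Module.finrank ℚ V) → ℝ) :=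
    {x | ∀ g ∈ S, 0 < m ⬝ᵥ toReal g → 0 < ∑ j, (L g j : ℝ) * x j}
  have hU : IsOpen U := by
    have : U = ⋂ g ∈ S, {x | 0 < m ⬝ᵥ toReal g → 0 < ∑ j, (L g j : ℝ) * x j} := by
      ext x; simp [U]
    rw [this]
    refine isOpen_biInter_finset fun g _ => ?_
    by_cases h : 0 < m ⬝ᵥ toReal g
    · simp only [h, true_imp_iff]
      exact isOpen_lt continuous_const (by fun_prop)
    · simp [h]
  have hd : DenseRange (fun q : Fin (Module.finrank ℚ V) → ℚ => fun j => (q j : ℝ)) :=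
    DenseRange.piMap fun _ => Rat.denseRange_cast
  obtain ⟨q, hq⟩ := hd.exists_mem_open hU ⟨fun j => (b j : ℝ), fun g _ h => by rwa [← hmL]⟩
  let p : ι → ℚ := fun i => ∑ j, c i j * q j
  have hp : ∀ g : ι → ℤ, (fun i => (p i : ℝ)) ⬝ᵥ toReal g = ∑ j, (L g j : ℝ) * (q j : ℝ) := by
    intro g
    rw [← hL]
    congr 1
    ext i
    simp [p]
  let D : ℕ := ∏ i, (p i).den
  have hD : 0 < D := Finset.prod_pos fun i _ => (p i).den_pos
  have hint : ∀ i, ∃ z : ℤ, (z : ℝ) = D * (p i : ℝ) := by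
    intro i
    obtain ⟨k, hk⟩ : (p i).den ∣ D := Finset.dvd_prod_of_mem _ (Finset.mem_univ i)
    refine ⟨k * (p i).num, ?_⟩
    have h : ((p i).den : ℝ) * (p i : ℝ) = (p i).num := by
      exact_mod_cast Rat.den_mul_eq_num (p i)
    rw [hk]
    push_cast
    rw [← h]
    ring
  choose z hz using hint
  have hzg : ∀ g : ι → ℤ, toReal z ⬝ᵥ toReal g = D * ∑ j, (L g j : ℝ) * (q j : ℝ) := by
    intro g
    rw [← hp, dotProduct, dotProduct, Finset.mul_sum]
    refine Finset.sum_congr rfl fun i _ => ?_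
    rw [show toReal z i = D * (p i : ℝ) from hz i]
    ring
  have hD' : (0 : ℝ) < D := by exact_mod_cast hD
  refine ⟨z, fun g hg => ?_⟩
  rw [hzg]
  rcases (hm g hg).eq_or_lt with h | h
  · have h0 : ∑ j, L g j • b j = 0 := by
      apply Subtype.ext
      simp only [Submodule.coe_sum, Submodule.coe_smul, Submodule.coe_zero]
      rw [h, hmL]
      exact Finset.sum_congr rfl fun j _ => Rat.smul_def _ _
    have h1 := Fintype.linearIndependent_iff.1 b.linearIndependent _ h0
    simp [h1, ← h]
  · have h1 := hq g hg h
    exact ⟨(mul_pos hD' h1).le, iff_of_false (mul_pos hD' h1).ne' h.ne'⟩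

/-- Linear functionals are nonnegative on a cone as soon as they are so on generators. -/
lemma nonneg_of_generators {S : Set (ι → ℝ)} {m : ι → ℝ} (h : ∀ g ∈ S, 0 ≤ m ⬝ᵥ g) :
    ∀ u ∈ PointedCone.hull ℝ S, 0 ≤ m ⬝ᵥ u := by
  intro u hu
  induction hu using Submodule.span_induction with
  | mem x hx => exact h x hx
  | zero => simp
  | add x y _ _ hx hy => rw [dotProduct_add]; exact add_nonneg hx hy
  | smul a x _ hx =>
    rw [show a • x = (a : ℝ) • x from rfl, dotProduct_smul]
    exact mul_nonneg a.2 hx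

lemma exists_face_integral {τ σ : PointedCone ℝ (ι → ℝ)} (hσ : IsRationalPolyhedral σ)
    (h : IsFace τ σ) : ∃ m ∈ dualMonoid σ, ∀ u, u ∈ τ ↔ u ∈ σ ∧ toReal m ⬝ᵥ u = 0 := by
  obtain ⟨S, rfl⟩ := hσ
  obtain ⟨m, hm, hτ⟩ := h
  obtain ⟨m', hm'⟩ := exists_integral S m fun g hg =>
    hm _ (Submodule.subset_span ⟨g, hg, rfl⟩)
  have hnn : ∀ u ∈ PointedCone.hull ℝ (toReal '' (S : Set (ι → ℤ))), 0 ≤ toReal m' ⬝ᵥ u := by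
    apply nonneg_of_generators
    rintro _ ⟨g, hg, rfl⟩
    exact (hm' g hg).1
  refine ⟨m', hnn, fun u => (hτ u).trans (and_congr_right fun hu => ?_)⟩
  induction hu using Submodule.span_induction with
  | mem x hx =>
    obtain ⟨g, hg, rfl⟩ := hx
    exact (hm' g hg).2.symm
  | zero => simp
  | add x y hx hy ihx ihy =>
    rw [dotProduct_add, dotProduct_add, add_eq_zero_iff_of_nonneg (hm x hx) (hm y hy),
      add_eq_zero_iff_of_nonneg (hnn x hx) (hnn y hy), ihx, ihy]
  | smul a x _ hx =>
    rw [show a • x = (a : ℝ) • x from rfl, dotProduct_smul, dotProduct_smul, smul_eq_zero,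
      smul_eq_zero, hx]

lemma exists_add_nsmul_mem {τ σ : PointedCone ℝ (ι → ℝ)} (hσ : IsRationalPolyhedral σ)
    {m : ι → ℤ} (hm : m ∈ dualMonoid σ) (h : ∀ u, u ∈ τ ↔ u ∈ σ ∧ toReal m ⬝ᵥ u = 0)
    {w : ι → ℤ} (hw : w ∈ dualMonoid τ) : ∃ k : ℕ, w + k • m ∈ dualMonoid σ := by
  obtain ⟨S, rfl⟩ := hσ
  have hcast : ∀ a g : ι → ℤ, toReal a ⬝ᵥ toReal g = ((a ⬝ᵥ g : ℤ) : ℝ) := by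
    intro a g
    simp [dotProduct, toReal]
  refine ⟨∑ g ∈ S, (w ⬝ᵥ g).natAbs, nonneg_of_generators ?_⟩
  rintro _ ⟨g, hg, rfl⟩
  have hgσ : toReal g ∈ PointedCone.hull ℝ (toReal '' (S : Set (ι → ℤ))) :=
    Submodule.subset_span ⟨g, hg, rfl⟩
  have hmg := hm _ hgσ
  have hwg : m ⬝ᵥ g = 0 → 0 ≤ w ⬝ᵥ g := by
    intro h0
    have := hw _ ((h _).2 ⟨hgσ, by rw [hcast, h0, Int.cast_zero]⟩)
    rw [hcast] at this
    exact_mod_cast this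
  rw [hcast] at hmg ⊢
  have hmg' : 0 ≤ m ⬝ᵥ g := by exact_mod_cast hmg
  have hk : (w ⬝ᵥ g).natAbs ≤ ∑ g ∈ S, (w ⬝ᵥ g).natAbs :=
    Finset.single_le_sum (f := fun g => (w ⬝ᵥ g).natAbs) (fun _ _ => Nat.zero_le _) hg
  generalize (∑ g ∈ S, (w ⬝ᵥ g).natAbs) = k at hk
  rw [add_dotProduct, smul_dotProduct, nsmul_eq_mul]
  norm_cast
  rcases hmg'.eq_or_lt with h0 | h0
  · rw [← h0]
    simpa using hwg h0.symm
  · have h1 : (k : ℤ) * 1 ≤ (k : ℤ) * (m ⬝ᵥ g) :=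
      mul_le_mul_of_nonneg_left (by omega) (by omega)
    omega

lemma isLocalization_dualMap {τ σ : PointedCone ℝ (ι → ℝ)} (hσ : IsRationalPolyhedral σ)
    (hle : τ ≤ σ) {m : ι → ℤ} (hm : m ∈ dualMonoid σ)
    (h : ∀ u, u ∈ τ ↔ u ∈ σ ∧ toReal m ⬝ᵥ u = 0) :
    letI := (dualMap hle).toAlgebra
    IsLocalization.Away (AddMonoidAlgebra.single (⟨m, hm⟩ : dualMonoid σ) (1 : ℂ))
      (AddMonoidAlgebra ℂ (dualMonoid τ)) := by
  let _ := (dualMap hle).toAlgebra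
  have hmap : ∀ x, algebraMap (AddMonoidAlgebra ℂ (dualMonoid σ))
      (AddMonoidAlgebra ℂ (dualMonoid τ)) x = dualMap hle x := fun _ => rfl
  have hsingle : ∀ (a : dualMonoid σ) (c : ℂ), dualMap hle (AddMonoidAlgebra.single a c) =
      AddMonoidAlgebra.single (AddSubmonoid.inclusion (dualMonoid_anti hle) a) c := by
    intro a c
    simp [dualMap]
  have hinj : Function.Injective (dualMap hle) :=
    AddMonoidAlgebra.mapDomain_injective (AddSubmonoid.inclusion_injective _)
  have hneg : -m ∈ dualMonoid τ := by
    intro u hu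
    have h1 : toReal (-m) = -toReal m := by ext; simp [toReal]
    rw [h1, neg_dotProduct, ((h u).1 hu).2, neg_zero]
  have hpow : ∀ k : ℕ, (AddMonoidAlgebra.single (⟨m, hm⟩ : dualMonoid σ) (1 : ℂ)) ^ k =
      AddMonoidAlgebra.single (k • (⟨m, hm⟩ : dualMonoid σ)) (1 : ℂ) := by
    intro k
    rw [AddMonoidAlgebra.single_pow, one_pow]
  have hsurj : ∀ z : AddMonoidAlgebra ℂ (dualMonoid τ), ∃ (k : ℕ) (x : _),
      z * dualMap hle ((AddMonoidAlgebra.single (⟨m, hm⟩ : dualMonoid σ) (1 : ℂ)) ^ k) =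
        dualMap hle x := by
    intro z
    induction z using AddMonoidAlgebra.induction_linear with
    | zero => exact ⟨0, 0, by simp⟩
    | add a b ha hb =>
      obtain ⟨k, x, hx⟩ := ha
      obtain ⟨l, y, hy⟩ := hb
      refine ⟨k + l, x * (AddMonoidAlgebra.single (⟨m, hm⟩ : dualMonoid σ) (1 : ℂ)) ^ l +
        y * (AddMonoidAlgebra.single (⟨m, hm⟩ : dualMonoid σ) (1 : ℂ)) ^ k, ?_⟩
      rw [map_add, map_mul, map_mul, ← hx, ← hy, pow_add, map_mul]
      ring
    | single a c =>
      obtain ⟨k, hk⟩ := exists_add_nsmul_mem hσ hm h a.2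
      refine ⟨k, AddMonoidAlgebra.single ⟨_, hk⟩ c, ?_⟩
      rw [hpow, hsingle, hsingle, AddMonoidAlgebra.single_mul_single, mul_one]
      congr 1
  refine IsLocalization.Away.mk _ ?_ ?_ ?_
  · refine IsUnit.of_mul_eq_one (AddMonoidAlgebra.single (⟨-m, hneg⟩ : dualMonoid τ) (1 : ℂ)) ?_
    rw [hmap, hsingle, AddMonoidAlgebra.single_mul_single, mul_one, AddMonoidAlgebra.one_def]
    congr 1
    exact Subtype.ext (add_neg_cancel m)
  · intro z
    obtain ⟨k, x, hx⟩ := hsurj z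
    exact ⟨k, x, by rw [hmap, hmap, ← map_pow, hx]⟩
  · intro a b hab
    rw [hmap, hmap] at hab
    exact ⟨0, by rw [hinj hab]⟩

/-- In a fan, an inclusion of cones is the inclusion of a face, cut out by a lattice vector. -/
lemma Fan.exists_face (F : Fan ι) {τ σ : F.cones} (hle : τ ≤ σ) :
    ∃ m ∈ dualMonoid σ.1, ∀ u, u ∈ τ.1 ↔ u ∈ σ.1 ∧ toReal m ⬝ᵥ u = 0 := by
  have h := (F.isFan.inter_face σ.1 σ.2 τ.1 τ.2).1
  rw [inf_eq_right.2 hle] at h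
  exact exists_face_integral (F.isFan.rational σ.1 σ.2) h

instance Fan.isOpenImmersion (F : Fan ι) {τ σ : F.cones} (f : τ ⟶ σ) :
    IsOpenImmersion ((gluingDiagram F.cones).map f) := by
  obtain ⟨m, hm, h⟩ := F.exists_face (leOfHom f)
  let _ := (dualMap (leOfHom f)).toAlgebra
  have := isLocalization_dualMap (F.isFan.rational σ.1 σ.2) (leOfHom f) hm h
  exact IsOpenImmersion.of_isLocalization
    (AddMonoidAlgebra.single (⟨m, hm⟩ : dualMonoid σ.1) (1 : ℂ))

lemma mem_range_map_iff (F : Fan ι) {τ σ : F.cones} (f : τ ⟶ σ) {m : ι → ℤ}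
    (hm : m ∈ dualMonoid σ.1) (h : ∀ u, u ∈ τ.1 ↔ u ∈ σ.1 ∧ toReal m ⬝ᵥ u = 0)
    (x : (gluingDiagram F.cones).obj σ) :
    (∃ y, (gluingDiagram F.cones).map f y = x) ↔
      AddMonoidAlgebra.single (⟨m, hm⟩ : dualMonoid σ.1) (1 : ℂ) ∉
        PrimeSpectrum.asIdeal (R := AddMonoidAlgebra ℂ (dualMonoid σ.1)) x := by
  let _ := (dualMap (leOfHom f)).toAlgebra
  have := isLocalization_dualMap (F.isFan.rational σ.1 σ.2) (leOfHom f) hm h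
  have hr := PrimeSpectrum.localization_away_comap_range (AddMonoidAlgebra ℂ (dualMonoid τ.1))
    (AddMonoidAlgebra.single (⟨m, hm⟩ : dualMonoid σ.1) (1 : ℂ))
  exact Set.ext_iff.1 hr x

instance Fan.isLocallyDirected (F : Fan ι) :
    (gluingDiagram F.cones ⋙ Scheme.forget).IsLocallyDirected where
  cond := by
    intro i j k fi fj xi xj hx
    obtain ⟨a, ha, hia⟩ := F.exists_face (leOfHom fi)
    obtain ⟨b, hb, hjb⟩ := F.exists_face (leOfHom fj)
    let l : F.cones := ⟨i.1 ⊓ j.1,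
      F.isFan.face_mem i.1 i.2 _ (F.isFan.inter_face i.1 i.2 j.1 j.2).1⟩
    let gi : l ⟶ i := homOfLE (inf_le_left : i.1 ⊓ j.1 ≤ i.1)
    let gj : l ⟶ j := homOfLE (inf_le_right : i.1 ⊓ j.1 ≤ j.1)
    have hl : ∀ u, u ∈ l.1 ↔ u ∈ k.1 ∧ toReal (a + b) ⬝ᵥ u = 0 := by
      intro u
      have hab : toReal (a + b) = toReal a + toReal b := by ext; simp [toReal]
      change u ∈ i.1 ∧ u ∈ j.1 ↔ _
      rw [hia, hjb, hab, add_dotProduct]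
      constructor
      · rintro ⟨⟨h1, h2⟩, _, h3⟩
        exact ⟨h1, by rw [h2, h3, add_zero]⟩
      · rintro ⟨h1, h2⟩
        have h3 := (add_eq_zero_iff_of_nonneg (ha u h1) (hb u h1)).1 h2
        exact ⟨⟨h1, h3.1⟩, h1, h3.2⟩
    have hx' : (gluingDiagram F.cones).map fi xi = (gluingDiagram F.cones).map fj xj := hx
    have h1 := (mem_range_map_iff F fi ha hia _).1 ⟨xi, rfl⟩
    have h2 := (mem_range_map_iff F fj hb hjb _).1 ⟨xj, rfl⟩
    rw [← hx'] at h2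
    obtain ⟨y, hy⟩ := (mem_range_map_iff F (gi ≫ fi) (add_mem ha hb) hl
      ((gluingDiagram F.cones).map fi xi)).2 (by
        intro hmem
        have hmul : AddMonoidAlgebra.single (⟨a + b, add_mem ha hb⟩ : dualMonoid k.1) (1 : ℂ) =
            AddMonoidAlgebra.single (⟨a, ha⟩ : dualMonoid k.1) (1 : ℂ) *
              AddMonoidAlgebra.single (⟨b, hb⟩ : dualMonoid k.1) (1 : ℂ) := by
          rw [AddMonoidAlgebra.single_mul_single, mul_one]
          rfl
        rw [hmul] at hmem
        exact (Ideal.IsPrime.mem_or_mem (PrimeSpectrum.isPrime _) hmem).elim h1 h2)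
    refine ⟨l, gi, gj, y, ?_, ?_⟩
    · apply ((gluingDiagram F.cones).map fi).isOpenEmbedding.injective
      rw [← hy, Functor.map_comp]
      rfl
    · apply ((gluingDiagram F.cones).map fj).isOpenEmbedding.injective
      rw [← hx', ← hy, Subsingleton.elim (gi ≫ fi) (gj ≫ fj), Functor.map_comp]
      rfl

/-- The toric variety `X(Σ)` of a fan `Σ`: the scheme obtained by gluing the affine toric varieties
`U_σ = Spec ℂ[σ^∨ ∩ M]`, `σ ∈ Σ`, along the open subschemes `U_{σ ∩ τ}`. -/
def Fan.toricVariety (F : Fan ι) : Scheme.{0} := colimit (gluingDiagram F.cones)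

/-- The inclusion of the affine chart `U_σ` into `X(Σ)`. -/
def Fan.chart (F : Fan ι) (σ : F.cones) : affineToric σ.1 ⟶ F.toricVariety :=
  colimit.ι (gluingDiagram F.cones) σ

/-- The structure morphism `X(Σ) ⟶ Spec ℂ`. -/
def Fan.structureMorphism (F : Fan ι) : F.toricVariety ⟶ Spec (CommRingCat.of ℂ) :=
  colimit.desc (gluingDiagram F.cones)
    { pt := Spec (CommRingCat.of ℂ)
      ι :=
        { app := fun σ =>
            Spec.map (CommRingCat.ofHom (algebraMap ℂ (AddMonoidAlgebra ℂ (dualMonoid σ.1))))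
          naturality := by
            intro τ σ f
            simp only [gluingDiagram, Functor.const_obj_obj, Functor.const_obj_map,
              Category.comp_id]
            rw [← Spec.map_comp, ← CommRingCat.ofHom_comp, dualMap,
              AddMonoidAlgebra.mapDomainRingHom_comp_algebraMap] } }

/-- The algebraic torus `T = Spec ℂ[M]`. -/
abbrev torus (ι : Type) : Scheme.{0} :=
  Spec (CommRingCat.of (AddMonoidAlgebra ℂ (ι → ℤ)))

/-- The inclusion of the torus `T = Spec ℂ[M]` into `X(Σ)` through the chart `U_σ`. -/
def Fan.torusInclusion (F : Fan ι) (σ : F.cones) : torus ι ⟶ F.toricVariety :=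
  Spec.map (CommRingCat.ofHom
    (AddMonoidAlgebra.mapDomainRingHom ℂ (dualMonoid σ.1).subtype)) ≫ F.chart σ

end ToricVariety

/-! ### The fan `Δ^{(n)}` and the polyhedron `P̃^{(n)}`

Throughout `r = n - 1`, so that `N̄ = M̄ = ℤ^r`, the symmetric group `𝔖_n` is `Perm (Fin (r + 1))`,
and `N = ℤ ⊕ N̄ ⊕ ℤ`, `M = ℤ ⊕ M̄ ⊕ ℤ`. -/

section Permutahedron

/-- The coordinates of `ℤ ⊕ ℤ^r ⊕ ℤ`. -/
abbrev Idx (r : ℕ) : Type := Unit ⊕ Fin r ⊕ Unit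

/-- The vector `(a, w, c)` of `R ⊕ R^r ⊕ R`. -/
abbrev vec {R : Type*} {r : ℕ} (a : R) (w : Fin r → R) (c : R) : Idx r → R :=
  Sum.elim (fun _ => a) (Sum.elim w fun _ => c)

/-- The entries `w_1, …, w_{n-1}` of the middle part of `x`, extended by `w_n = 0`. -/
def middle {R : Type*} [Zero R] {r : ℕ} (x : Idx r → R) : Fin (r + 1) → R :=
  Fin.snoc (α := fun _ => R) (fun i => x (Sum.inr (Sum.inl i))) 0

@[simp] lemma middle_castSucc {R : Type*} [Zero R] {r : ℕ} (x : Idx r → R) (i : Fin r) :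
    middle x i.castSucc = x (Sum.inr (Sum.inl i)) := by simp [middle]

@[simp] lemma middle_last {R : Type*} [Zero R] {r : ℕ} (x : Idx r → R) :
    middle x (Fin.last r) = 0 := by simp [middle]

lemma middle_add {R : Type*} [AddCommGroup R] {r : ℕ} (x y : Idx r → R) (k : Fin (r + 1)) :
    middle (x + y) k = middle x k + middle y k := by
  refine Fin.lastCases ?_ (fun i => ?_) k <;> simp

lemma middle_smul {R : Type*} [CommRing R] {r : ℕ} (c : R) (x : Idx r → R) (k : Fin (r + 1)) :
    middle (c • x) k = c * middle x k := by
  refine Fin.lastCases ?_ (fun i => ?_) k <;> simp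

/-- The action of `𝔖_n` on `R ⊕ R^{n-1} ⊕ R`: with `w_n = 0` and `d = w_{s⁻¹(n)}`, the permutation
`s` sends `(a, w, c)` to `(a - d, (w_{s⁻¹(i)} - d)_i, c + d)`. By `symAction_swap` and
`symAction_swap_last` below, it is the action in which the simple transpositions `(k k+1)`,
`k ≤ n - 2`, interchange the coordinates `w_k` and `w_{k+1}`, and `(n-1 n)` sends `(a, w, c)` to
`(a - w_{n-1}, (w_1 - w_{n-1}, …, w_{n-2} - w_{n-1}, -w_{n-1}), c + w_{n-1})`. -/
def symAction (R : Type*) [CommRing R] (r : ℕ) :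
    Representation R (Equiv.Perm (Fin (r + 1))) (Idx r → R) where
  toFun s :=
    { toFun := fun x =>
        vec (x (Sum.inl ()) - middle x (s⁻¹ (Fin.last r)))
          (fun i => middle x (s⁻¹ i.castSucc) - middle x (s⁻¹ (Fin.last r)))
          (x (Sum.inr (Sum.inr ())) + middle x (s⁻¹ (Fin.last r)))
      map_add' := by
        intro x y
        ext (_ | i | _) <;> simp [middle_add] <;> ring
      map_smul' := by
        intro c x
        ext (_ | i | _) <;> simp [middle_smul] <;> ring }
  map_one' := by
    refine LinearMap.ext fun x => ?_
    ext (_ | i | _) <;> simp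
  map_mul' := by
    intro s t
    refine LinearMap.ext fun x => ?_
    have h : ∀ (a c : R) (k : Fin (r + 1)), middle (vec a
        (fun i => middle x (t⁻¹ i.castSucc) - middle x (t⁻¹ (Fin.last r))) c) k =
          middle x (t⁻¹ k) - middle x (t⁻¹ (Fin.last r)) := by
      intro a c k
      refine Fin.lastCases ?_ (fun i => ?_) k
      · rw [middle_last, sub_self]
      · rw [middle_castSucc]; rfl
    ext (_ | i | _) <;>
      simp only [LinearMap.coe_mk, AddHom.coe_mk, Module.End.mul_apply, Sum.elim_inl, Sum.elim_inr,
        mul_inv_rev, Equiv.Perm.mul_apply, h] <;> ring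

lemma symAction_swap (R : Type*) [CommRing R] (r : ℕ) (i j : Fin r) (x : Idx r → R) :
    symAction R r (Equiv.swap i.castSucc j.castSucc) x =
      x ∘ Equiv.swap (Sum.inr (Sum.inl i)) (Sum.inr (Sum.inl j)) := by
  have hlast : (Equiv.swap i.castSucc j.castSucc) (Fin.last r) = Fin.last r :=
    Equiv.swap_apply_of_ne_of_ne (Fin.castSucc_lt_last i).ne' (Fin.castSucc_lt_last j).ne'
  ext (_ | k | _)
  · simp [symAction, hlast, Equiv.swap_apply_of_ne_of_ne]
  · simp only [symAction, MonoidHom.coe_mk, OneHom.coe_mk, LinearMap.coe_mk, AddHom.coe_mk,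
      Equiv.swap_inv, hlast, middle_last, sub_zero, Sum.elim_inr, Sum.elim_inl,
      Function.comp_apply]
    rcases eq_or_ne k i with rfl | hi
    · simp
    rcases eq_or_ne k j with rfl | hj
    · simp
    rw [Equiv.swap_apply_of_ne_of_ne (by simpa using hi) (by simpa using hj),
      Equiv.swap_apply_of_ne_of_ne (by simpa using hi) (by simpa using hj), middle_castSucc]
  · simp [symAction, hlast, Equiv.swap_apply_of_ne_of_ne]

lemma symAction_swap_last (R : Type*) [CommRing R] (q : ℕ) (x : Idx (q + 1) → R) :
    symAction R (q + 1) (Equiv.swap (Fin.last q).castSucc (Fin.last (q + 1))) x =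
      vec (x (Sum.inl ()) - x (Sum.inr (Sum.inl (Fin.last q))))
        (fun i => if i = Fin.last q then -x (Sum.inr (Sum.inl (Fin.last q)))
          else x (Sum.inr (Sum.inl i)) - x (Sum.inr (Sum.inl (Fin.last q))))
        (x (Sum.inr (Sum.inr ())) + x (Sum.inr (Sum.inl (Fin.last q)))) := by
  ext (_ | k | _)
  · simp [symAction]
  · simp only [symAction, MonoidHom.coe_mk, OneHom.coe_mk, LinearMap.coe_mk, AddHom.coe_mk,
      Equiv.swap_inv, Equiv.swap_apply_right, middle_castSucc, Sum.elim_inr, Sum.elim_inl]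
    rcases eq_or_ne k (Fin.last q) with rfl | hk
    · simp
    rw [Equiv.swap_apply_of_ne_of_ne (by simpa using hk) (Fin.castSucc_lt_last k).ne,
      middle_castSucc, if_neg hk]
  · simp [symAction]

/-- The cone `δ^{(n)}`, generated by the vectors `(1, e_1 + ⋯ + e_j, 0)` for `0 ≤ j ≤ n - 1` and
the vector `(0, 0, 1)`. -/
def delta (r : ℕ) : PointedCone ℝ (Idx r → ℝ) :=
  PointedCone.hull ℝ
    (Set.range (fun j : Fin (r + 1) =>
        vec (1 : ℝ) (fun i : Fin r => if (i : ℕ) < (j : ℕ) then 1 else 0) 0) ∪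
      {vec (0 : ℝ) (fun _ : Fin r => 0) 1})

/-- The translate `s δ^{(n)}`. -/
def deltaTranslate (r : ℕ) (s : Equiv.Perm (Fin (r + 1))) : PointedCone ℝ (Idx r → ℝ) :=
  PointedCone.map (symAction ℝ r s) (delta r)

/-- The fan `Δ^{(n)}`: all faces of the cones `s δ^{(n)}`, `s ∈ 𝔖_n`. -/
def DeltaFan (r : ℕ) : Set (PointedCone ℝ (Idx r → ℝ)) :=
  {τ | ∃ s : Equiv.Perm (Fin (r + 1)), IsFace τ (deltaTranslate r s)}

/-- The support `σ^{(n)}` of `Δ^{(n)}`: the union of the maximal cones `s δ^{(n)}`. -/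
def sigmaCone (r : ℕ) : Set (Idx r → ℝ) :=
  ⋃ s : Equiv.Perm (Fin (r + 1)), (deltaTranslate r s : Set (Idx r → ℝ))

/-- The dual cone `σ^{(n)∨}` in `M_ℝ`. -/
def sigmaDual (r : ℕ) : Set (Idx r → ℝ) :=
  {m | ∀ u ∈ sigmaCone r, 0 ≤ m ⬝ᵥ u}

/-- The permutahedron `P^{(n)}` in `ℝ^{n-1}`: the convex hull of the points
`v_s = (s(1), …, s(n-1)) - (1, …, n-1)`, `s ∈ 𝔖_n`. -/
def permutahedron (r : ℕ) : Set (Fin r → ℝ) :=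
  convexHull ℝ (Set.range fun s : Equiv.Perm (Fin (r + 1)) =>
    fun i : Fin r => ((s i.castSucc : ℕ) : ℝ) - ((i : ℕ) : ℝ))

/-- The polyhedron `P̃^{(n)} = σ^{(n)∨} + ι P^{(n)}`, where `ι` is the inclusion of `M̄_ℝ` as the
middle summand of `M_ℝ = ℝ ⊕ M̄_ℝ ⊕ ℝ`. -/
def tildeP (r : ℕ) : Set (Idx r → ℝ) :=
  sigmaDual r + (fun w : Fin r → ℝ => vec (0 : ℝ) w 0) '' permutahedron r

end Permutahedron

end Toric

end

/-!
A functional that attains its minimum on `P̃` is nonnegative on `σ^∨`, hence lies in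
`σ = ⋃ s, s δ`, because `σ = {a ≥ w_k ≥ -c for all k}` is closed and convex. So it is enough to
see that `P̃` has, for every `s`, a point whose normal cone is `s δ` and from which all directions
of the dual of `s δ` can be followed inside `P̃`: the cones of the normal fan are then exactly the
faces of the cones `s δ`, and cones of a normal fan always meet in common faces.

Now `s δ` is the simplicial cone `a ≥ w_{s(1)} ≥ ⋯ ≥ w_{s(n)} ≥ -c`. The rearrangement inequality
says that its elements are minimal on `P` at the vertex of `s⁻¹`. Conversely, each of its facet
normals is a direction that can be followed inside `P̃` from that vertex: `a - w_{s(1)}` and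
`w_{s(n)} + c` belong to `σ^∨`, and `w_{s(i)} - w_{s(i+1)}` leads to a neighbouring vertex of `P`.
-/

namespace Toric

section Faces

variable {ι : Type}

lemma IsRationalPolyhedral.fg {σ : PointedCone ℝ (ι → ℝ)} (hσ : IsRationalPolyhedral σ) :
    σ.FG := by
  obtain ⟨S, rfl⟩ := hσ
  exact Submodule.fg_span (S.finite_toSet.image toReal)

variable [Fintype ι]

lemma dotProduct_eq_zero_of_generators {S : Set (ι → ℝ)} {m : ι → ℝ} (h : ∀ g ∈ S, m ⬝ᵥ g = 0) :
    ∀ u ∈ PointedCone.hull ℝ S, m ⬝ᵥ u = 0 := by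
  intro u hu
  refine le_antisymm ?_ (nonneg_of_generators (fun g hg => (h g hg).ge) u hu)
  have hneg := nonneg_of_generators (m := -m) (fun g hg => by simp [h g hg]) u hu
  rwa [neg_dotProduct, Left.nonneg_neg_iff] at hneg

lemma mem_hull_sep_of_dotProduct_eq_zero {S : Set (ι → ℝ)} {m u : ι → ℝ}
    (hm : ∀ g ∈ S, 0 ≤ m ⬝ᵥ g) (hu : u ∈ PointedCone.hull ℝ S) (hu0 : m ⬝ᵥ u = 0) :
    u ∈ PointedCone.hull ℝ {g ∈ S | m ⬝ᵥ g = 0} := by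
  have hnn := nonneg_of_generators hm
  induction hu using Submodule.span_induction with
  | mem g hg => exact Submodule.subset_span ⟨hg, hu0⟩
  | zero => exact zero_mem _
  | add x y hx hy ihx ihy =>
    rw [dotProduct_add, add_eq_zero_iff_of_nonneg (hnn x hx) (hnn y hy)] at hu0
    exact add_mem (ihx hu0.1) (ihy hu0.2)
  | smul c x _ ih =>
    rw [← Nonneg.coe_smul, dotProduct_smul, smul_eq_zero] at hu0
    rcases hu0 with hc | hx0
    · rw [show c = 0 from Subtype.ext hc, zero_smul]
      exact zero_mem _
    · exact Submodule.smul_mem _ c (ih hx0)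

namespace IsFace

variable {σ τ ρ : PointedCone ℝ (ι → ℝ)}

lemma le (h : IsFace τ σ) : τ ≤ σ := by
  obtain ⟨m, -, hτ⟩ := h
  exact fun u hu => ((hτ u).1 hu).1

lemma exists_subset_eq_hull {S : Set (ι → ℝ)} (h : IsFace τ (PointedCone.hull ℝ S)) :
    ∃ T ⊆ S, τ = PointedCone.hull ℝ T := by
  obtain ⟨m, hm, hτ⟩ := h
  have hmS : ∀ g ∈ S, 0 ≤ m ⬝ᵥ g := fun g hg => hm g (Submodule.subset_span hg)
  refine ⟨{g ∈ S | m ⬝ᵥ g = 0}, Set.sep_subset _ _, le_antisymm (fun u hu => ?_) ?_⟩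
  · obtain ⟨hu, hu0⟩ := (hτ u).1 hu
    exact mem_hull_sep_of_dotProduct_eq_zero hmS hu hu0
  · exact Submodule.span_le.2 fun g hg => (hτ g).2 ⟨Submodule.subset_span hg.1, hg.2⟩

lemma fg (h : IsFace τ σ) (hσ : σ.FG) : τ.FG := by
  obtain ⟨S, rfl⟩ := hσ
  obtain ⟨T, hTS, rfl⟩ := h.exists_subset_eq_hull
  exact Submodule.fg_span (S.finite_toSet.subset hTS)

lemma isRationalPolyhedral (h : IsFace τ σ) (hσ : IsRationalPolyhedral σ) :
    IsRationalPolyhedral τ := by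
  classical
  obtain ⟨S, rfl⟩ := hσ
  obtain ⟨T, hTS, rfl⟩ := h.exists_subset_eq_hull
  obtain ⟨S', hS', rfl⟩ := Set.subset_image_iff.1 hTS
  exact ⟨(S.finite_toSet.subset hS').toFinset, by rw [Set.Finite.coe_toFinset]⟩

/-- If `m₁` cuts `τ` out of `σ` and `m₂` cuts `ρ` out of `τ`, then `c m₁ + m₂` cuts `ρ` out of `σ`
for `c` large. -/
lemma trans (hρτ : IsFace ρ τ) (hτσ : IsFace τ σ) (hσ : σ.FG) : IsFace ρ σ := by
  obtain ⟨S, rfl⟩ := hσ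
  obtain ⟨m₁, hm₁, hτ⟩ := hτσ
  obtain ⟨m₂, hm₂, hρ⟩ := hρτ
  obtain ⟨c, hc⟩ : ∃ c, ∀ g ∈ S, -(m₂ ⬝ᵥ g) / (m₁ ⬝ᵥ g) ≤ c := by
    obtain ⟨c, hc⟩ := (S.image fun g => -(m₂ ⬝ᵥ g) / (m₁ ⬝ᵥ g)).exists_le
    exact ⟨c, fun g hg => hc _ (Finset.mem_image_of_mem _ hg)⟩
  have hnn : ∀ u ∈ PointedCone.hull ℝ (S : Set (ι → ℝ)), 0 ≤ (c • m₁ + m₂) ⬝ᵥ u := by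
    refine nonneg_of_generators fun g hg => ?_
    have hgσ : g ∈ PointedCone.hull ℝ (S : Set (ι → ℝ)) := Submodule.subset_span hg
    rw [add_dotProduct, smul_dotProduct, smul_eq_mul]
    rcases (hm₁ g hgσ).eq_or_lt with h₀ | h₀
    · rw [← h₀, mul_zero, zero_add]
      exact hm₂ g ((hτ g).2 ⟨hgσ, h₀.symm⟩)
    · linarith [(div_le_iff₀ h₀).1 (hc g hg)]
  have hsum : ∀ u, ((c + 1) • m₁ + m₂) ⬝ᵥ u = m₁ ⬝ᵥ u + (c • m₁ + m₂) ⬝ᵥ u := fun u => by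
    simp only [add_dotProduct, smul_dotProduct, smul_eq_mul]
    ring
  refine ⟨(c + 1) • m₁ + m₂, fun u hu => ?_, fun u => ?_⟩
  · rw [hsum]
    exact add_nonneg (hm₁ u hu) (hnn u hu)
  · rw [hρ, hτ, and_assoc, hsum]
    refine and_congr_right fun hu => ?_
    rw [add_eq_zero_iff_of_nonneg (hm₁ u hu) (hnn u hu)]
    refine and_congr_right fun h₁ => ?_
    rw [add_dotProduct, smul_dotProduct, h₁, smul_zero, zero_add]

end IsFace

lemma finite_setOf_isFace {σ : PointedCone ℝ (ι → ℝ)} (hσ : σ.FG) : {τ | IsFace τ σ}.Finite := by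
  obtain ⟨S, rfl⟩ := hσ
  refine (S.finite_toSet.finite_subsets.image fun T => PointedCone.hull ℝ T).subset fun τ hτ => ?_
  obtain ⟨T, hTS, rfl⟩ := hτ.exists_subset_eq_hull
  exact ⟨T, hTS, rfl⟩

/-- One functional per generator suffices, and the sum of finitely many nonnegative functionals
vanishes exactly where all of them do. -/
lemma isFace_of_forall_dotProduct_eq_zero {σ τ : PointedCone ℝ (ι → ℝ)} {L : Set (ι → ℝ)}
    (hσ : σ.FG) (hL : ∀ m ∈ L, ∀ u ∈ σ, 0 ≤ m ⬝ᵥ u)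
    (hτ : ∀ u, u ∈ τ ↔ u ∈ σ ∧ ∀ m ∈ L, m ⬝ᵥ u = 0) : IsFace τ σ := by
  obtain ⟨S, rfl⟩ := hσ
  have hsep : ∀ g, ∃ q ∈ insert 0 L, q ⬝ᵥ g = 0 → ∀ m ∈ L, m ⬝ᵥ g = 0 := fun g => by
    by_cases h : ∀ m ∈ L, m ⬝ᵥ g = 0
    · exact ⟨0, Set.mem_insert _ _, fun _ => h⟩
    · push Not at h
      obtain ⟨m, hm, hmg⟩ := h
      exact ⟨m, Set.mem_insert_of_mem _ hm, fun h0 => absurd h0 hmg⟩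
  choose q hqL hq using hsep
  have hq0 : ∀ g, ∀ u ∈ PointedCone.hull ℝ (S : Set (ι → ℝ)), 0 ≤ q g ⬝ᵥ u := fun g u hu => by
    rcases hqL g with h | h
    · rw [h, zero_dotProduct]
    · exact hL _ h u hu
  have hnn : ∀ u ∈ PointedCone.hull ℝ (S : Set (ι → ℝ)), 0 ≤ (∑ g ∈ S, q g) ⬝ᵥ u := fun u hu => by
    rw [sum_dotProduct]
    exact Finset.sum_nonneg fun g _ => hq0 g u hu
  refine ⟨∑ g ∈ S, q g, hnn, fun u => (hτ u).trans (and_congr_right fun hu => ⟨fun h => ?_, ?_⟩)⟩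
  · rw [sum_dotProduct]
    refine Finset.sum_eq_zero fun g _ => ?_
    rcases hqL g with h' | h'
    · rw [h', zero_dotProduct]
    · exact h _ h'
  · intro hu0 m hm
    refine dotProduct_eq_zero_of_generators ?_ u <| mem_hull_sep_of_dotProduct_eq_zero
      (fun g hg => hnn g (Submodule.subset_span hg)) hu hu0
    rintro g ⟨hg, hg0⟩
    rw [sum_dotProduct, Finset.sum_eq_zero_iff_of_nonneg fun g' _ =>
      hq0 g' g (Submodule.subset_span hg)] at hg0
    exact hq g (hg0 g hg) m hm

end Faces

section NormalFans

variable {ι : Type} [Fintype ι] {P Q R : Set (ι → ℝ)} {v u x : ι → ℝ}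

/-- The face of `P` on which the functional `· ⬝ᵥ x` is minimal; it is empty if the minimum is not
attained. -/
def minFace (P : Set (ι → ℝ)) (x : ι → ℝ) : Set (ι → ℝ) := {q ∈ P | ∀ p ∈ P, q ⬝ᵥ x ≤ p ⬝ᵥ x}

lemma mem_normalCone_singleton : u ∈ normalCone P {v} ↔ ∀ p ∈ P, v ⬝ᵥ u ≤ p ⬝ᵥ u :=
  ⟨fun h => h v rfl, fun h _ hq => hq ▸ h⟩

lemma mem_minFace_iff : v ∈ minFace P x ↔ v ∈ P ∧ x ∈ normalCone P {v} := by
  rw [mem_normalCone_singleton]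
  rfl

lemma minFace_subset : minFace P x ⊆ P := Set.sep_subset _ _

lemma normalCone_anti (h : R ⊆ Q) : normalCone P Q ≤ normalCone P R :=
  fun _ hu q hq => hu q (h hq)

lemma mem_normalFan_iff {σ : PointedCone ℝ (ι → ℝ)} :
    σ ∈ normalFan P ↔ ∃ x, (minFace P x).Nonempty ∧ σ = normalCone P (minFace P x) := by
  classical
  constructor
  · rintro ⟨Q, hne, hQ, rfl⟩
    obtain ⟨l, rfl⟩ := hQ hne
    set x := (dotProductEquiv ℝ ι).symm (-l.toLinearMap) with hx
    have hl : ∀ y, y ⬝ᵥ x = -l y := fun y => by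
      rw [dotProduct_comm, ← dotProductEquiv_apply_apply, hx, LinearEquiv.apply_symm_apply]
      rfl
    have hface : {q ∈ P | ∀ p ∈ P, l p ≤ l q} = minFace P x := by
      simp only [minFace, hl, neg_le_neg_iff]
    exact ⟨x, hface ▸ hne, by rw [hface]⟩
  · rintro ⟨x, hne, rfl⟩
    refine ⟨_, hne, fun _ => ⟨(-dotProductEquiv ℝ ι x).toContinuousLinearMap, ?_⟩, rfl⟩
    simp [minFace, dotProduct_comm x]

lemma isFace_normalCone_inf (hQ : Q.Nonempty) (hQP : Q ⊆ P) (hRP : R ⊆ P)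
    (hfg : (normalCone P Q).FG) : IsFace (normalCone P Q ⊓ normalCone P R) (normalCone P Q) := by
  obtain ⟨q, hq⟩ := hQ
  have hnn : ∀ p ∈ P, ∀ u ∈ normalCone P Q, 0 ≤ (p - q) ⬝ᵥ u := fun p hp u hu => by
    rw [sub_dotProduct]
    exact sub_nonneg.2 (hu q hq p hp)
  refine isFace_of_forall_dotProduct_eq_zero (L := (fun p => p - q) '' R) hfg ?_ fun u => ?_
  · rintro _ ⟨p, hp, rfl⟩
    exact hnn p (hRP hp)
  · rw [Submodule.mem_inf, Set.forall_mem_image]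
    refine and_congr_right fun hu => ⟨fun h p hp => le_antisymm ?_ (hnn p (hRP hp) u hu), ?_⟩
    · rw [sub_dotProduct]
      exact sub_nonpos.2 (h p hp q (hQP hq))
    · intro h p hp p' hp'
      have hpq := h hp
      rw [sub_dotProduct, sub_eq_zero] at hpq
      exact hpq ▸ hu q hq p' hp'

lemma minFace_sum_subset {T : Finset (ι → ℝ)} (hv : v ∈ P) (hT : ∀ g ∈ T, g ∈ normalCone P {v})
    {g : ι → ℝ} (hg : g ∈ T) : minFace P (∑ g ∈ T, g) ⊆ minFace P g := by
  rintro q ⟨hq, hmin⟩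
  refine ⟨hq, fun p hp => ?_⟩
  have hle : ∀ p ∈ P, ∀ g ∈ T, v ⬝ᵥ g ≤ p ⬝ᵥ g := fun p hp g hg =>
    mem_normalCone_singleton.1 (hT g hg) p hp
  have hsum : ∑ g ∈ T, v ⬝ᵥ g = ∑ g ∈ T, q ⬝ᵥ g := by
    refine le_antisymm (Finset.sum_le_sum (hle q hq)) ?_
    rw [← dotProduct_sum, ← dotProduct_sum]
    exact hmin v hv
  rw [← (Finset.sum_eq_sum_iff_of_le (hle q hq)).1 hsum g hg]
  exact hle p hp g hg

/-- `P` is conical at its point `v`: every direction in the dual of the normal cone at `v` can be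
followed from `v` for some time inside `P`. Polyhedra have this property at all of their points,
a disc has it at none of its boundary points. -/
def IsConicalAt (P : Set (ι → ℝ)) (v : ι → ℝ) : Prop :=
  v ∈ P ∧ ∀ m : ι → ℝ, (∀ u ∈ normalCone P {v}, 0 ≤ m ⬝ᵥ u) → ∃ ε > (0 : ℝ), v + ε • m ∈ P

lemma IsConicalAt.dotProduct_eq_zero {m : ι → ℝ} (hv : IsConicalAt P v)
    (hm : ∀ u ∈ normalCone P {v}, 0 ≤ m ⬝ᵥ u) (hx : x ∈ normalCone P {v}) (hmx : m ⬝ᵥ x = 0)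
    (hu : u ∈ normalCone P (minFace P x)) : m ⬝ᵥ u = 0 := by
  obtain ⟨ε, hε, hmem⟩ := hv.2 m hm
  have hvx : v ∈ minFace P x := mem_minFace_iff.2 ⟨hv.1, hx⟩
  have hmx' : v + ε • m ∈ minFace P x := by
    refine ⟨hmem, fun p hp => ?_⟩
    rw [add_dotProduct, smul_dotProduct, hmx, smul_zero, add_zero]
    exact hvx.2 p hp
  have hle := hu _ hmx' v hv.1
  rw [add_dotProduct, smul_dotProduct, add_le_iff_nonpos_right, smul_eq_mul] at hle
  exact le_antisymm (nonpos_of_mul_nonpos_right hle hε)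
    (hm u (normalCone_anti (Set.singleton_subset_iff.2 hvx) hu))

/-- The functional `x` is the sum of the generators of the face, hence a relative interior point. -/
lemma IsConicalAt.exists_normalCone_minFace_eq {τ : PointedCone ℝ (ι → ℝ)} (hv : IsConicalAt P v)
    (hfg : (normalCone P {v}).FG) (hτ : IsFace τ (normalCone P {v})) :
    ∃ x, v ∈ minFace P x ∧ normalCone P (minFace P x) = τ := by
  obtain ⟨T, hT⟩ := hτ.fg hfg
  have hTτ : ∀ g ∈ T, g ∈ τ := fun g hg => hT ▸ Submodule.subset_span hg
  have hTσ : ∀ g ∈ T, g ∈ normalCone P {v} := fun g hg => hτ.le (hTτ g hg)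
  have hx : ∑ g ∈ T, g ∈ τ := sum_mem hTτ
  have hvx : v ∈ minFace P (∑ g ∈ T, g) := mem_minFace_iff.2 ⟨hv.1, hτ.le hx⟩
  refine ⟨_, hvx, le_antisymm (fun u hu => ?_) ?_⟩
  · obtain ⟨m, hm, hτ⟩ := hτ
    exact (hτ u).2 ⟨normalCone_anti (Set.singleton_subset_iff.2 hvx) hu,
      hv.dotProduct_eq_zero hm ((hτ _).1 hx).1 ((hτ _).1 hx).2 hu⟩
  · rw [← hT]
    exact Submodule.span_le.2 fun g hg q hq => (minFace_sum_subset hv.1 hTσ hg hq).2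

variable {α : Type*} {w : α → ι → ℝ} {σ : PointedCone ℝ (ι → ℝ)}

theorem mem_normalFan_iff_exists_isFace (hw : ∀ a, IsConicalAt P (w a))
    (hfg : ∀ a, (normalCone P {w a}).FG)
    (hmin : ∀ x, (minFace P x).Nonempty → ∃ a, w a ∈ minFace P x) :
    σ ∈ normalFan P ↔ ∃ a, IsFace σ (normalCone P {w a}) := by
  rw [mem_normalFan_iff]
  constructor
  · rintro ⟨x, hne, rfl⟩
    obtain ⟨a, ha⟩ := hmin x hne
    have ha' : {w a} ⊆ minFace P x := Set.singleton_subset_iff.2 ha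
    refine ⟨a, ?_⟩
    rw [← inf_eq_right.2 (normalCone_anti ha')]
    exact isFace_normalCone_inf (Set.singleton_nonempty _) (ha'.trans minFace_subset)
      minFace_subset (hfg a)
  · rintro ⟨a, ha⟩
    obtain ⟨x, hx, rfl⟩ := (hw a).exists_normalCone_minFace_eq (hfg a) ha
    exact ⟨x, ⟨w a, hx⟩, rfl⟩

theorem isFan_normalFan [Finite α] (hw : ∀ a, IsConicalAt P (w a))
    (hrat : ∀ a, IsRationalPolyhedral (normalCone P {w a}))
    (hstrong : ∀ a, ∀ u ∈ normalCone P {w a}, -u ∈ normalCone P {w a} → u = 0)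
    (hmin : ∀ x, (minFace P x).Nonempty → ∃ a, w a ∈ minFace P x) : IsFan (normalFan P) := by
  have hfg := fun a => (hrat a).fg
  have hmem : ∀ {σ}, σ ∈ normalFan P ↔ ∃ a, IsFace σ (normalCone P {w a}) :=
    mem_normalFan_iff_exists_isFace hw hfg hmin
  have hinf : ∀ σ ∈ normalFan P, ∀ τ ∈ normalFan P, IsFace (σ ⊓ τ) σ := by
    intro σ hσ τ hτ
    obtain ⟨a, ha⟩ := hmem.1 hσ
    obtain ⟨x, hne, rfl⟩ := mem_normalFan_iff.1 hσ
    obtain ⟨y, -, rfl⟩ := mem_normalFan_iff.1 hτ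
    exact isFace_normalCone_inf hne minFace_subset minFace_subset (ha.fg (hfg a))
  refine ⟨?_, fun σ hσ => ?_, fun σ hσ u hu hu' => ?_, fun σ hσ τ hτσ => ?_, fun σ hσ τ hτ => ?_⟩
  · refine (Set.finite_iUnion fun a => finite_setOf_isFace (hfg a)).subset fun σ hσ => ?_
    exact Set.mem_iUnion.2 (hmem.1 hσ)
  · obtain ⟨a, ha⟩ := hmem.1 hσ
    exact ha.isRationalPolyhedral (hrat a)
  · obtain ⟨a, ha⟩ := hmem.1 hσ
    exact hstrong a u (ha.le hu) (ha.le hu')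
  · obtain ⟨a, ha⟩ := hmem.1 hσ
    exact hmem.2 ⟨a, hτσ.trans ha (hfg a)⟩
  · exact ⟨hinf σ hσ τ hτ, inf_comm τ σ ▸ hinf τ hτ σ hσ⟩

end NormalFans

section DualBases

variable {κ ι R : Type*} [Fintype ι] [CommRing R] [DecidableEq κ] {f g : κ → ι → R}

/-- The families `f` and `g` are bases of `ι → R` which are dual to each other with respect to the
dot product. That they are bases is encoded in the equality of cardinalities. -/
structure AreDualBases [Fintype κ] (f g : κ → ι → R) : Prop where
  card_eq : Fintype.card κ = Fintype.card ι
  dotProduct_eq : ∀ k l, f k ⬝ᵥ g l = if k = l then 1 else 0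

namespace AreDualBases

variable [Fintype κ]

lemma symm (h : AreDualBases f g) : AreDualBases g f where
  card_eq := h.card_eq
  dotProduct_eq k l := by simp only [dotProduct_comm, h.dotProduct_eq, eq_comm]

lemma sum_dotProduct_smul (h : AreDualBases f g) (x : ι → R) : ∑ k, (f k ⬝ᵥ x) • g k = x := by
  classical
  have hfg : Matrix.of f * (Matrix.of g).transpose = 1 := by
    ext k l
    exact (h.dotProduct_eq k l).trans (Matrix.one_apply ..).symm
  have hgf := (Matrix.mul_eq_one_comm_of_card_eq κ ι R h.card_eq).1 hfg
  calc ∑ k, (f k ⬝ᵥ x) • g k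
      = Matrix.mulVec (Matrix.of g).transpose (Matrix.mulVec (Matrix.of f) x) := by
        ext i
        simp [Matrix.mulVec, dotProduct, mul_comm]
    _ = x := by rw [Matrix.mulVec_mulVec, hgf, Matrix.one_mulVec]

lemma eq_zero_of_dotProduct_eq_zero (h : AreDualBases f g) {x : ι → R} (hx : ∀ k, f k ⬝ᵥ x = 0) :
    x = 0 := by
  rw [← h.sum_dotProduct_smul x]
  exact Finset.sum_eq_zero fun k _ => by rw [hx k, zero_smul]

lemma mem_hull_range_iff {ι : Type} [Fintype ι] {f g : κ → ι → ℝ} (h : AreDualBases f g)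
    {x : ι → ℝ} : x ∈ PointedCone.hull ℝ (Set.range g) ↔ ∀ k, 0 ≤ f k ⬝ᵥ x := by
  refine ⟨fun hx k => nonneg_of_generators ?_ x hx, fun hx => ?_⟩
  · rintro _ ⟨l, rfl⟩
    rw [h.dotProduct_eq]
    split_ifs <;> simp
  · rw [← h.sum_dotProduct_smul x]
    exact sum_mem fun k _ => PointedCone.smul_mem _ (hx k) (Submodule.subset_span ⟨k, rfl⟩)

lemma eq_zero_of_mem_hull_range_of_neg_mem {ι : Type} [Fintype ι] {f g : κ → ι → ℝ}
    (h : AreDualBases f g) {x : ι → ℝ} (hx : x ∈ PointedCone.hull ℝ (Set.range g))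
    (hx' : -x ∈ PointedCone.hull ℝ (Set.range g)) : x = 0 := by
  refine h.eq_zero_of_dotProduct_eq_zero fun k => ?_
  have hneg := h.mem_hull_range_iff.1 hx' k
  rw [dotProduct_neg, Left.nonneg_neg_iff] at hneg
  exact le_antisymm hneg (h.mem_hull_range_iff.1 hx k)

end AreDualBases

end DualBases

section Convexity

lemma exists_add_smul_mem_of_mem_hull {E : Type*} [AddCommGroup E] [Module ℝ E] {P D : Set E}
    {v m : E} (hP : Convex ℝ P) (hv : v ∈ P) (hD : ∀ d ∈ D, v + d ∈ P)
    (hm : m ∈ PointedCone.hull ℝ D) : ∃ ε > (0 : ℝ), v + ε • m ∈ P := by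
  induction hm using Submodule.span_induction with
  | mem d hd => exact ⟨1, one_pos, by rw [one_smul]; exact hD d hd⟩
  | zero => exact ⟨1, one_pos, by rwa [smul_zero, add_zero]⟩
  | add x y _ _ hx hy =>
    obtain ⟨a, ha, hax⟩ := hx
    obtain ⟨b, hb, hby⟩ := hy
    refine ⟨b / (a + b) * a, by positivity, ?_⟩
    have hmid : (b / (a + b)) • (v + a • x) + (a / (a + b)) • (v + b • y) =
        v + (b / (a + b) * a) • (x + y) := by
      match_scalars <;> field_simp
      ring
    rw [← hmid]
    exact hP hax hby (by positivity) (by positivity) (by field_simp; ring)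
  | smul c x _ hx =>
    obtain ⟨ε, hε, hx⟩ := hx
    rcases c.2.eq_or_lt with hc | hc
    · refine ⟨1, one_pos, ?_⟩
      rwa [show c = 0 from Subtype.ext hc.symm, zero_smul, smul_zero, add_zero]
    · refine ⟨ε / c, div_pos hε hc, ?_⟩
      rwa [← Nonneg.coe_smul, smul_smul, div_mul_cancel₀ _ hc.ne']

lemma le_dotProduct_of_mem_add_convexHull {ι : Type*} [Fintype ι] {C V : Set (ι → ℝ)}
    {p u : ι → ℝ} {a : ℝ} (hC : ∀ m ∈ C, 0 ≤ m ⬝ᵥ u) (hV : ∀ w ∈ V, a ≤ w ⬝ᵥ u)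
    (hp : p ∈ C + convexHull ℝ V) : a ≤ p ⬝ᵥ u := by
  obtain ⟨m, hm, w, hw, rfl⟩ := hp
  have hlin : IsLinearMap ℝ fun w : ι → ℝ => w ⬝ᵥ u :=
    ⟨fun w w' => add_dotProduct w w' u, fun c w => smul_dotProduct c w u⟩
  have hw' : a ≤ w ⬝ᵥ u := convexHull_min hV (convex_halfSpace_ge hlin a) hw
  rw [add_dotProduct]
  exact le_add_of_nonneg_of_le (hC m hm) hw'

end Convexity

section TorusInclusion

variable {ι : Type} [Fintype ι]

lemma Fan.torusInclusion_of_le (F : Fan ι) {τ σ : F.cones} (h : τ ≤ σ) :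
    F.torusInclusion τ = F.torusInclusion σ := by
  have hchart : F.chart τ = Spec.map (CommRingCat.ofHom (dualMap h)) ≫ F.chart σ :=
    (colimit.w (gluingDiagram F.cones) (homOfLE h)).symm
  rw [torusInclusion, torusInclusion, hchart, ← Category.assoc, ← Spec.map_comp,
    ← CommRingCat.ofHom_comp, dualMap, ← AddMonoidAlgebra.mapDomainRingHom_comp]
  rfl

lemma Fan.torusInclusion_eq (F : Fan ι) (σ τ : F.cones) :
    F.torusInclusion σ = F.torusInclusion τ := by
  let l : F.cones := ⟨σ.1 ⊓ τ.1,
    F.isFan.face_mem σ.1 σ.2 _ (F.isFan.inter_face σ.1 σ.2 τ.1 τ.2).1⟩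
  have hlσ : l ≤ σ := (inf_le_left : σ.1 ⊓ τ.1 ≤ σ.1)
  have hlτ : l ≤ τ := (inf_le_right : σ.1 ⊓ τ.1 ≤ τ.1)
  rw [← F.torusInclusion_of_le hlσ, F.torusInclusion_of_le hlτ]

lemma exists_toricVariety_iso {C D : Set (PointedCone ℝ (ι → ℝ))} (h : C = D) (hC : IsFan C)
    (hD : IsFan D) :
    ∃ e : Fan.toricVariety ⟨C, hC⟩ ≅ Fan.toricVariety ⟨D, hD⟩,
      e.hom ≫ Fan.structureMorphism ⟨D, hD⟩ = Fan.structureMorphism ⟨C, hC⟩ ∧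
      ∀ (σ : C) (τ : D),
        Fan.torusInclusion ⟨C, hC⟩ σ ≫ e.hom = Fan.torusInclusion ⟨D, hD⟩ τ := by
  subst h
  exact ⟨Iso.refl _, Category.id_comp _, fun σ τ =>
    (Category.comp_id _).trans (Fan.torusInclusion_eq ⟨C, hC⟩ σ τ)⟩

end TorusInclusion

section NormalFanTildeP

variable {r : ℕ}

lemma symAction_inl {R : Type*} [CommRing R] (s : Equiv.Perm (Fin (r + 1))) (x : Idx r → R) :
    symAction R r s x (Sum.inl ()) = x (Sum.inl ()) - middle x (s⁻¹ (Fin.last r)) := rfl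

lemma symAction_inr_inr {R : Type*} [CommRing R] (s : Equiv.Perm (Fin (r + 1))) (x : Idx r → R) :
    symAction R r s x (Sum.inr (Sum.inr ())) =
      x (Sum.inr (Sum.inr ())) + middle x (s⁻¹ (Fin.last r)) := rfl

lemma middle_symAction {R : Type*} [CommRing R] (s : Equiv.Perm (Fin (r + 1))) (x : Idx r → R)
    (k : Fin (r + 1)) :
    middle (symAction R r s x) k = middle x (s⁻¹ k) - middle x (s⁻¹ (Fin.last r)) := by
  refine Fin.lastCases ?_ (fun i => ?_) k
  · rw [middle_last, sub_self]
  · rw [middle_castSucc]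
    rfl

@[simp] lemma toReal_apply {ι : Type} (x : ι → ℤ) (i : ι) : toReal x i = x i := rfl

lemma middle_toReal (x : Idx r → ℤ) (k : Fin (r + 1)) :
    middle (toReal x) k = ((middle x k : ℤ) : ℝ) := by
  refine Fin.lastCases ?_ (fun i => ?_) k <;> simp

lemma toReal_symAction (s : Equiv.Perm (Fin (r + 1))) (x : Idx r → ℤ) :
    toReal (symAction ℤ r s x) = symAction ℝ r s (toReal x) := by
  ext (_ | i | _) <;> simp [symAction, middle_toReal]

/-- The functional `(a, w, c) ↦ a`. -/
def firstCoord : Idx r → ℝ := Pi.single (Sum.inl ()) 1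

/-- The functional `(a, w, c) ↦ w_k`, where `w_n = 0`. -/
def middleCoord (k : Fin (r + 1)) : Idx r → ℝ :=
  Fin.snoc (α := fun _ => Idx r → ℝ) (fun i => Pi.single (Sum.inr (Sum.inl i)) 1) 0 k

/-- The functional `(a, w, c) ↦ c`. -/
def lastCoord : Idx r → ℝ := Pi.single (Sum.inr (Sum.inr ())) 1

@[simp] lemma firstCoord_dotProduct (x : Idx r → ℝ) : firstCoord ⬝ᵥ x = x (Sum.inl ()) :=
  single_one_dotProduct _ x

@[simp] lemma middleCoord_dotProduct (k : Fin (r + 1)) (x : Idx r → ℝ) :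
    middleCoord k ⬝ᵥ x = middle x k := by
  refine Fin.lastCases ?_ (fun i => ?_) k <;> simp [middleCoord]

@[simp] lemma lastCoord_dotProduct (x : Idx r → ℝ) :
    lastCoord ⬝ᵥ x = x (Sum.inr (Sum.inr ())) :=
  single_one_dotProduct _ x

/-- The functionals `a, w_{s(1)}, …, w_{s(n)}, -c`, in this order. The cone `s δ^{(n)}` consists of
the vectors on which they take decreasing values. -/
def chainCoord (s : Equiv.Perm (Fin (r + 1))) : Fin (r + 3) → Idx r → ℝ :=
  Fin.cons firstCoord (Fin.snoc (α := fun _ => Idx r → ℝ) (fun k => middleCoord (s k)) (-lastCoord))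

@[simp] lemma chainCoord_zero (s : Equiv.Perm (Fin (r + 1))) : chainCoord s 0 = firstCoord := rfl

@[simp] lemma chainCoord_succ_castSucc (s : Equiv.Perm (Fin (r + 1))) (k : Fin (r + 1)) :
    chainCoord s k.castSucc.succ = middleCoord (s k) := by
  simp [chainCoord]

@[simp] lemma chainCoord_last (s : Equiv.Perm (Fin (r + 1))) :
    chainCoord s (Fin.last (r + 2)) = -lastCoord :=
  Fin.snoc_last (α := fun _ => Idx r → ℝ) (-lastCoord) fun k => middleCoord (s k)

lemma chainCoord_dotProduct_symAction (s : Equiv.Perm (Fin (r + 1))) (p : Fin (r + 3))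
    (x : Idx r → ℝ) : chainCoord s p ⬝ᵥ symAction ℝ r s x =
      chainCoord 1 p ⬝ᵥ x - middle x (s⁻¹ (Fin.last r)) := by
  refine Fin.cases ?_ (Fin.lastCases ?_ fun k => ?_) p
  · simp [symAction_inl]
  · simp [symAction_inr_inr, sub_eq_neg_add]
  · simp [middle_symAction]

/-- The primitive inner normals of the facets of `s δ^{(n)}`. -/
def facetNormal (s : Equiv.Perm (Fin (r + 1))) (k : Fin (r + 2)) : Idx r → ℝ :=
  chainCoord s k.castSucc - chainCoord s k.succ

lemma facetNormal_zero (s : Equiv.Perm (Fin (r + 1))) :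
    facetNormal s 0 = firstCoord - middleCoord (s 0) :=
  congrArg (firstCoord - ·) (chainCoord_succ_castSucc s 0)

lemma facetNormal_succ_castSucc (s : Equiv.Perm (Fin (r + 1))) (i : Fin r) :
    facetNormal s i.castSucc.succ = middleCoord (s i.castSucc) - middleCoord (s i.succ) :=
  congrArg₂ (· - ·) (chainCoord_succ_castSucc s i.castSucc) (chainCoord_succ_castSucc s i.succ)

lemma facetNormal_last (s : Equiv.Perm (Fin (r + 1))) :
    facetNormal s (Fin.last (r + 1)) = middleCoord (s (Fin.last r)) + lastCoord := by
  have hmiddle := chainCoord_succ_castSucc s (Fin.last r)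
  rw [Fin.succ_castSucc, Fin.succ_last] at hmiddle
  rw [facetNormal, hmiddle, Fin.succ_last, chainCoord_last, sub_neg_eq_add]

lemma facetNormal_dotProduct_symAction (s : Equiv.Perm (Fin (r + 1))) (k : Fin (r + 2))
    (x : Idx r → ℝ) : facetNormal s k ⬝ᵥ symAction ℝ r s x = facetNormal 1 k ⬝ᵥ x := by
  simp only [facetNormal, sub_dotProduct, chainCoord_dotProduct_symAction, sub_sub_sub_cancel_right]

/-- The generators of `δ^{(n)}`, as lattice vectors. -/
def deltaRay : Fin (r + 2) → Idx r → ℤ :=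
  Fin.snoc (α := fun _ => Idx r → ℤ)
    (fun j : Fin (r + 1) => vec 1 (fun i => if (i : ℕ) < (j : ℕ) then 1 else 0) 0) (vec 0 0 1)

lemma delta_eq_hull_range : delta r = PointedCone.hull ℝ (Set.range (toReal ∘ deltaRay)) := by
  have hmiddle (j : Fin (r + 1)) :
      toReal (vec 1 (fun i : Fin r => if (i : ℕ) < (j : ℕ) then 1 else 0) 0) =
        vec (1 : ℝ) (fun i => if (i : ℕ) < (j : ℕ) then 1 else 0) 0 := by
    ext (_ | i | _) <;> simp
  have hlast : toReal (vec 0 0 1 : Idx r → ℤ) = vec (0 : ℝ) (fun _ => 0) 1 := by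
    ext (_ | i | _) <;> simp
  rw [delta, deltaRay, Set.range_comp, Fin.range_snoc, Set.image_insert_eq, ← Set.range_comp,
    Set.union_singleton, hlast]
  simp only [Function.comp_def, hmiddle]

lemma middle_deltaRay_castSucc (j k : Fin (r + 1)) :
    middle (deltaRay j.castSucc) k = if k < j then 1 else 0 := by
  refine Fin.lastCases ?_ (fun i => ?_) k
  · simp [(Fin.le_last j).not_gt]
  · simp [deltaRay, Fin.lt_def]

lemma middle_deltaRay_last (k : Fin (r + 1)) : middle (deltaRay (Fin.last (r + 1))) k = 0 := by
  refine Fin.lastCases ?_ (fun i => ?_) k <;> simp [deltaRay]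

lemma chainCoord_one_dotProduct_deltaRay (p : Fin (r + 3)) (l : Fin (r + 2)) :
    chainCoord 1 p ⬝ᵥ toReal (deltaRay l) =
      (if (p : ℕ) ≤ l then 1 else 0) - if l = Fin.last (r + 1) then 1 else 0 := by
  refine Fin.cases ?_ (Fin.lastCases ?_ fun k => ?_) p
  · refine Fin.lastCases ?_ (fun j => ?_) l <;> simp [deltaRay]
  · refine Fin.lastCases ?_ (fun j => ?_) l <;> simp [deltaRay]
  · refine Fin.lastCases ?_ (fun j => ?_) l
    · simp [middle_toReal, middle_deltaRay_last, k.is_le]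
    · simp [middle_toReal, middle_deltaRay_castSucc]

/-- The generators of `s δ^{(n)}`. -/
def ray (s : Equiv.Perm (Fin (r + 1))) (k : Fin (r + 2)) : Idx r → ℝ :=
  toReal (symAction ℤ r s (deltaRay k))

lemma areDualBases_facetNormal_ray (s : Equiv.Perm (Fin (r + 1))) :
    AreDualBases (facetNormal s) (ray s) where
  card_eq := by
    simp only [Fintype.card_fin, Fintype.card_sum, Fintype.card_unique]
    omega
  dotProduct_eq k l := by
    rw [ray, toReal_symAction, facetNormal_dotProduct_symAction, facetNormal, sub_dotProduct,
      chainCoord_one_dotProduct_deltaRay, chainCoord_one_dotProduct_deltaRay,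
      sub_sub_sub_cancel_right, Fin.val_castSucc, Fin.val_succ]
    split_ifs <;> first | omega | simp

lemma deltaTranslate_eq_hull_range_ray (s : Equiv.Perm (Fin (r + 1))) :
    deltaTranslate r s = PointedCone.hull ℝ (Set.range (ray s)) := by
  have hray : ray s = symAction ℝ r s ∘ toReal ∘ deltaRay := funext fun k => toReal_symAction s _
  rw [deltaTranslate, delta_eq_hull_range, hray]
  rw [Set.range_comp (symAction ℝ r s), Set.range_comp]
  exact Submodule.map_span (LinearMap.restrictScalars {c : ℝ // 0 ≤ c} (symAction ℝ r s)) _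

lemma mem_deltaTranslate_iff_facetNormal {s : Equiv.Perm (Fin (r + 1))} {u : Idx r → ℝ} :
    u ∈ deltaTranslate r s ↔ ∀ k, 0 ≤ facetNormal s k ⬝ᵥ u := by
  rw [deltaTranslate_eq_hull_range_ray, (areDualBases_facetNormal_ray s).mem_hull_range_iff]

lemma mem_deltaTranslate_iff_antitone {s : Equiv.Perm (Fin (r + 1))} {u : Idx r → ℝ} :
    u ∈ deltaTranslate r s ↔ Antitone fun p => chainCoord s p ⬝ᵥ u := by
  simp only [mem_deltaTranslate_iff_facetNormal, facetNormal, sub_dotProduct, sub_nonneg,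
    Fin.antitone_iff_succ_le]

lemma isRationalPolyhedral_deltaTranslate (s : Equiv.Perm (Fin (r + 1))) :
    IsRationalPolyhedral (deltaTranslate r s) := by
  classical
  refine ⟨Finset.univ.image fun k => symAction ℤ r s (deltaRay k), ?_⟩
  rw [deltaTranslate_eq_hull_range_ray, Finset.coe_image, Finset.coe_univ, Set.image_univ,
    ← Set.range_comp]
  rfl

lemma mem_sigmaCone_iff {u : Idx r → ℝ} : u ∈ sigmaCone r ↔
    ∀ k, middle u k ≤ u (Sum.inl ()) ∧ -u (Sum.inr (Sum.inr ())) ≤ middle u k := by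
  simp only [sigmaCone, Set.mem_iUnion, SetLike.mem_coe, mem_deltaTranslate_iff_antitone]
  constructor
  · rintro ⟨s, hs⟩ k
    have hfirst := hs (Fin.zero_le (s⁻¹ k).castSucc.succ)
    have hlast := hs (Fin.succ_le_succ_iff.2 (Fin.le_last (s⁻¹ k).castSucc))
    constructor
    · simpa using hfirst
    · simpa using hlast
  · intro h
    set s := Tuple.sort fun k => -middle u k
    have hs : Monotone ((fun k => -middle u k) ∘ s) := Tuple.monotone_sort _
    have hmiddle (k : Fin (r + 1)) : chainCoord s k.castSucc.succ ⬝ᵥ u = middle u (s k) := by simp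
    refine ⟨s, Fin.antitone_iff_succ_le.2 <| Fin.cases ?_ (Fin.lastCases ?_ fun i => ?_)⟩
    · exact (hmiddle 0).trans_le (by simpa using (h (s 0)).1)
    · exact (show _ ≤ _ by simpa using (h (s (Fin.last r))).2).trans_eq (hmiddle (Fin.last r)).symm
    · have hle := neg_le_neg_iff.1 (hs (Fin.castSucc_le_succ i))
      exact (hmiddle i.succ).trans_le (hle.trans_eq (hmiddle i.castSucc).symm)

lemma firstCoord_sub_middleCoord_mem_sigmaDual (k : Fin (r + 1)) :
    firstCoord - middleCoord k ∈ sigmaDual r := fun u hu => by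
  simpa [sub_dotProduct] using (mem_sigmaCone_iff.1 hu k).1

lemma middleCoord_add_lastCoord_mem_sigmaDual (k : Fin (r + 1)) :
    middleCoord k + lastCoord ∈ sigmaDual r := fun u hu => by
  simpa [add_dotProduct, neg_le_iff_add_nonneg] using (mem_sigmaCone_iff.1 hu k).2

lemma mem_sigmaCone_iff_forall_sigmaDual {u : Idx r → ℝ} :
    u ∈ sigmaCone r ↔ ∀ m ∈ sigmaDual r, 0 ≤ m ⬝ᵥ u := by
  refine ⟨fun hu m hm => hm u hu, fun h => mem_sigmaCone_iff.2 fun k => ⟨?_, ?_⟩⟩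
  · simpa [sub_dotProduct] using h _ (firstCoord_sub_middleCoord_mem_sigmaDual k)
  · simpa [add_dotProduct, neg_le_iff_add_nonneg] using
      h _ (middleCoord_add_lastCoord_mem_sigmaDual k)

lemma convex_sigmaDual : Convex ℝ (sigmaDual r) := by
  intro m hm m' hm' a b ha hb _ u hu
  rw [add_dotProduct, smul_dotProduct, smul_dotProduct]
  exact add_nonneg (mul_nonneg ha (hm u hu)) (mul_nonneg hb (hm' u hu))

/-- The vertex of `P̃^{(n)}` with normal cone `s δ^{(n)}`. It comes from the generator of `P^{(n)}`
indexed by `s⁻¹`. -/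
def vertex (s : Equiv.Perm (Fin (r + 1))) : Idx r → ℝ :=
  vec 0 (fun i : Fin r => ((s⁻¹ i.castSucc : ℕ) : ℝ) - ((i : ℕ) : ℝ)) 0

lemma tildeP_eq_sigmaDual_add_convexHull :
    tildeP r = sigmaDual r + convexHull ℝ (Set.range vertex) := by
  have hlin : IsLinearMap ℝ fun w : Fin r → ℝ => (vec 0 w 0 : Idx r → ℝ) :=
    ⟨fun w w' => by ext (_ | i | _) <;> simp, fun c w => by ext (_ | i | _) <;> simp⟩
  rw [tildeP, permutahedron, hlin.image_convexHull, ← Set.range_comp,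
    ← (Equiv.inv (Equiv.Perm (Fin (r + 1)))).surjective.range_comp]
  rfl

lemma convex_tildeP : Convex ℝ (tildeP r) := by
  rw [tildeP_eq_sigmaDual_add_convexHull]
  exact convex_sigmaDual.add (convex_convexHull ℝ _)

lemma vertex_mem_tildeP (s : Equiv.Perm (Fin (r + 1))) : vertex s ∈ tildeP r := by
  rw [tildeP_eq_sigmaDual_add_convexHull]
  exact ⟨0, fun u _ => (zero_dotProduct u).ge, vertex s,
    subset_convexHull ℝ _ (Set.mem_range_self s), zero_add _⟩

lemma add_mem_tildeP {m p : Idx r → ℝ} (hp : p ∈ tildeP r) (hm : m ∈ sigmaDual r) :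
    p + m ∈ tildeP r := by
  obtain ⟨m', hm', w, hw, rfl⟩ := hp
  refine ⟨m' + m, fun u hu => ?_, w, hw, add_right_comm _ _ _⟩
  rw [add_dotProduct]
  exact add_nonneg (hm' u hu) (hm u hu)

lemma vertex_dotProduct (s : Equiv.Perm (Fin (r + 1))) (u : Idx r → ℝ) : vertex s ⬝ᵥ u =
    ∑ k, ((s⁻¹ k : ℕ) : ℝ) * middle u k - ∑ k : Fin (r + 1), ((k : ℕ) : ℝ) * middle u k := by
  rw [← Finset.sum_sub_distrib, Fin.sum_univ_castSucc]
  simp [vertex, dotProduct, Fintype.sum_sum_type, sub_mul]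

/-- This is the rearrangement inequality. -/
lemma vertex_dotProduct_le_vertex_dotProduct {s : Equiv.Perm (Fin (r + 1))} {u : Idx r → ℝ}
    (hu : u ∈ deltaTranslate r s) (t : Equiv.Perm (Fin (r + 1))) :
    vertex s ⬝ᵥ u ≤ vertex t ⬝ᵥ u := by
  have hval : Monotone fun k : Fin (r + 1) => ((k : ℕ) : ℝ) := fun _ _ h => Nat.cast_le.2 h
  have hmiddle : Antitone fun k => middle u (s k) := fun a b h => by
    simpa using mem_deltaTranslate_iff_antitone.1 hu
      (Fin.succ_le_succ_iff.2 (Fin.castSucc_le_castSucc_iff.2 h))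
  rw [vertex_dotProduct, vertex_dotProduct]
  refine sub_le_sub_right ?_ _
  calc ∑ k, ((s⁻¹ k : ℕ) : ℝ) * middle u k
      = ∑ k : Fin (r + 1), ((k : ℕ) : ℝ) * middle u (s k) := by
        rw [← Equiv.sum_comp s]
        simp
    _ ≤ ∑ k, (((t⁻¹ * s) k : ℕ) : ℝ) * middle u (s k) :=
        (hval.antivary hmiddle).sum_mul_le_sum_comp_perm_mul
    _ = ∑ k, ((t⁻¹ k : ℕ) : ℝ) * middle u k :=
        Equiv.sum_comp s fun k => ((t⁻¹ k : ℕ) : ℝ) * middle u k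

lemma cast_val_swap_castSucc_succ (i : Fin r) (q : Fin (r + 1)) :
    ((Equiv.swap i.castSucc i.succ q : ℕ) : ℝ) =
      (q : ℕ) + (if q = i.castSucc then 1 else 0) - if q = i.succ then 1 else 0 := by
  rcases eq_or_ne q i.castSucc with rfl | hcast
  · simp [i.castSucc_lt_succ.ne]
  rcases eq_or_ne q i.succ with rfl | hsucc
  · simp [hcast]
  simp [Equiv.swap_apply_of_ne_of_ne hcast hsucc, hcast, hsucc]

lemma vertex_add_middleCoord_sub (s : Equiv.Perm (Fin (r + 1))) (i : Fin r) :
    vertex s + (middleCoord (s i.castSucc) - middleCoord (s i.succ)) =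
      vertex (s * Equiv.swap i.castSucc i.succ) := by
  have hmiddleCoord (k : Fin (r + 1)) :
      middleCoord k = vec 0 (fun l : Fin r => if l.castSucc = k then 1 else 0) 0 := by
    refine dotProduct_eq _ _ fun u => ?_
    rw [middleCoord_dotProduct]
    refine Fin.lastCases ?_ (fun j => ?_) k
    · simp [dotProduct, Fintype.sum_sum_type, Fin.castSucc_ne_last]
    · simp [dotProduct, Fintype.sum_sum_type]
  rw [hmiddleCoord, hmiddleCoord]
  ext (_ | l | _)
  · simp [vertex]
  · simp only [vertex, Pi.add_apply, Pi.sub_apply, Sum.elim_inr, Sum.elim_inl, mul_inv_rev,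
      Equiv.swap_inv, Equiv.Perm.mul_apply, ← Equiv.Perm.inv_eq_iff_eq, cast_val_swap_castSucc_succ]
    ring
  · simp [vertex]

lemma vertex_add_facetNormal_mem_tildeP (s : Equiv.Perm (Fin (r + 1))) (k : Fin (r + 2)) :
    vertex s + facetNormal s k ∈ tildeP r := by
  refine Fin.cases ?_ (Fin.lastCases ?_ fun i => ?_) k
  · rw [facetNormal_zero]
    exact add_mem_tildeP (vertex_mem_tildeP s) (firstCoord_sub_middleCoord_mem_sigmaDual (s 0))
  · rw [Fin.succ_last, facetNormal_last]
    exact add_mem_tildeP (vertex_mem_tildeP s)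
      (middleCoord_add_lastCoord_mem_sigmaDual (s (Fin.last r)))
  · rw [facetNormal_succ_castSucc, vertex_add_middleCoord_sub]
    exact vertex_mem_tildeP _

lemma normalCone_tildeP_vertex (s : Equiv.Perm (Fin (r + 1))) :
    normalCone (tildeP r) {vertex s} = deltaTranslate r s := by
  ext u
  rw [mem_normalCone_singleton]
  constructor
  · refine fun hu => mem_deltaTranslate_iff_facetNormal.2 fun k => ?_
    have hle := hu _ (vertex_add_facetNormal_mem_tildeP s k)
    rwa [add_dotProduct, le_add_iff_nonneg_right] at hle
  · intro hu p hp
    rw [tildeP_eq_sigmaDual_add_convexHull] at hp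
    exact le_dotProduct_of_mem_add_convexHull (C := sigmaDual r)
      (fun m hm => hm u (Set.mem_iUnion.2 ⟨s, hu⟩))
      (Set.forall_mem_range.2 (vertex_dotProduct_le_vertex_dotProduct hu)) hp

lemma isConicalAt_tildeP_vertex (s : Equiv.Perm (Fin (r + 1))) :
    IsConicalAt (tildeP r) (vertex s) := by
  refine ⟨vertex_mem_tildeP s, fun m hm => ?_⟩
  have hm' : m ∈ PointedCone.hull ℝ (Set.range (facetNormal s)) := by
    refine (areDualBases_facetNormal_ray s).symm.mem_hull_range_iff.2 fun k => ?_
    rw [dotProduct_comm]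
    refine hm _ ?_
    rw [normalCone_tildeP_vertex, deltaTranslate_eq_hull_range_ray]
    exact Submodule.subset_span ⟨k, rfl⟩
  exact exists_add_smul_mem_of_mem_hull convex_tildeP (vertex_mem_tildeP s)
    (Set.forall_mem_range.2 (vertex_add_facetNormal_mem_tildeP s)) hm'

lemma exists_vertex_mem_minFace_tildeP {x : Idx r → ℝ} (hx : (minFace (tildeP r) x).Nonempty) :
    ∃ s, vertex s ∈ minFace (tildeP r) x := by
  obtain ⟨q, hq, hmin⟩ := hx
  have hxσ : x ∈ sigmaCone r := mem_sigmaCone_iff_forall_sigmaDual.2 fun m hm => by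
    have hle := hmin _ (add_mem_tildeP hq hm)
    rwa [add_dotProduct, le_add_iff_nonneg_right] at hle
  obtain ⟨s, hs⟩ := Set.mem_iUnion.1 hxσ
  refine ⟨s, mem_minFace_iff.2 ⟨vertex_mem_tildeP s, ?_⟩⟩
  rwa [normalCone_tildeP_vertex]

theorem normalFan_tildeP (r : ℕ) : normalFan (tildeP r) = DeltaFan r := by
  ext σ
  rw [mem_normalFan_iff_exists_isFace isConicalAt_tildeP_vertex
    (fun s => normalCone_tildeP_vertex s ▸ (isRationalPolyhedral_deltaTranslate s).fg)
    (fun _ => exists_vertex_mem_minFace_tildeP)]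
  simp only [normalCone_tildeP_vertex]
  rfl

theorem isFan_normalFan_tildeP (r : ℕ) : IsFan (normalFan (tildeP r)) := by
  refine isFan_normalFan isConicalAt_tildeP_vertex (fun s => ?_) (fun s u hu hu' => ?_)
    fun _ => exists_vertex_mem_minFace_tildeP
  · exact normalCone_tildeP_vertex s ▸ isRationalPolyhedral_deltaTranslate s
  · rw [normalCone_tildeP_vertex, deltaTranslate_eq_hull_range_ray] at hu hu'
    exact (areDualBases_facetNormal_ray s).eq_zero_of_mem_hull_range_of_neg_mem hu hu'

end NormalFanTildeP

end Toric

theorem mainTheorem6 (r : ℕ) :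
    Toric.normalFan (Toric.tildeP r) = Toric.DeltaFan r ∧
    ∃ (hP : Toric.IsFan (Toric.normalFan (Toric.tildeP r)))
      (hΔ : Toric.IsFan (Toric.DeltaFan r))
      (e : Toric.Fan.toricVariety ⟨_, hP⟩ ≅ Toric.Fan.toricVariety ⟨_, hΔ⟩),
      e.hom ≫ Toric.Fan.structureMorphism ⟨_, hΔ⟩ = Toric.Fan.structureMorphism ⟨_, hP⟩ ∧
      ∀ (σ : Toric.normalFan (Toric.tildeP r)) (τ : Toric.DeltaFan r),
        Toric.Fan.torusInclusion ⟨_, hP⟩ σ ≫ e.hom = Toric.Fan.torusInclusion ⟨_, hΔ⟩ τ := by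
  have h := Toric.normalFan_tildeP r
  have hP := Toric.isFan_normalFan_tildeP r
  have hΔ : Toric.IsFan (Toric.DeltaFan r) := h ▸ hP
  exact ⟨h, hP, hΔ, Toric.exists_toricVariety_iso h hP hΔ⟩
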